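/- Let $X\subset\mathbb{C}^{N}$ be a bounded domain (non-empty, open, connected) with Kobayashi distance $d$, let $\overline{X}$ be its Euclidean closure and $\partial X=\overline{X}\setminus X$. Fix $\kappa>0$. A $(1,\kappa)$-almost geodesic joining $x$ to $y$ is a continuous path $\sigma:[a,b]\to X$ with $\sigma(a)=x$, $\sigma(b)=y$ and $|t-s|-\kappa\le d(\sigma(t),\sigma(s))\le|t-s|+\kappa$ for all $s,t\in[a,b]$. Assume that $X$ is a visibility domain: for any two distinct points $\xi,\eta\in\partial X$ and any neighborhoods $V$ of $\xi$ and $W$ of $\eta$ in $\overline{X}$ with $\overline{V}\cap\overline{W}=\emptyset$ there is a compact set $K\subset X$ that meets every $(1,\kappa)$-almost geodesic joining a point of $V\cap X$ to a point of $W\cap X$. Fix $x_{0}\in X$. For $W\subset\overline X$ and $C\in\mathbb{R}$ put $H(W,C)=\{z\in X:\inf_{w\in W\cap X}d(z,w)\le d(z,x_{0})+C\}$, and for $\xi\in\partial X$ let $$S(\xi)=\overline{\bigcup_{C\ge 0}\ \bigcap_{V}\overline{H(V,C)}},$$ where $V$ runs over the open neighborhoods of $\xi$ in $\overline{X}$ and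 closures are taken in $\overline{X}$. Then $S(\xi)=\{\xi\}$ for every $\xi\in\partial X$ that is at infinite distance, i.e. such that $d(x_{0},x)\to\infty$ as $x\to\xi$, $x\in X$. In particular, if $(X,d)$ is a proper metric space (closed $d$-balls are compact), then $S(\xi)=\{\xi\}$ for every $\xi\in\partial X$. -/

import Mathlib

open Set Filter Topology

/-- The Poincaré distance of the unit disc (`a`, `b` are points of modulus less than one). -/
noncomputable def poincareDist (a b : ℂ) : ℝ :=
  Real.artanh (‖a - b‖ / ‖1 - (starRingEnd ℂ) b * a‖)

/-- `KobayashiChain X x y L`: there is a finite chain of holomorphic discs in `X` from `x` to `y`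
whose total Poincaré length is `L`. -/
inductive KobayashiChain {N : ℕ} (X : Set (EuclideanSpace ℂ (Fin N))) :
    EuclideanSpace ℂ (Fin N) → EuclideanSpace ℂ (Fin N) → ℝ → Prop
  | refl (x : EuclideanSpace ℂ (Fin N)) (hx : x ∈ X) : KobayashiChain X x x 0
  | step (x y : EuclideanSpace ℂ (Fin N)) (L : ℝ) (h : KobayashiChain X x y L)
      (f : ℂ → EuclideanSpace ℂ (Fin N))
      (hf : DifferentiableOn ℂ f (Metric.ball 0 1))
      (hfX : MapsTo f (Metric.ball 0 1) X)
      (a b : ℂ) (ha : a ∈ Metric.ball (0 : ℂ) 1) (hb : b ∈ Metric.ball (0 : ℂ) 1)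
      (hfa : f a = y) :
      KobayashiChain X x (f b) (L + poincareDist a b)

/-- The Kobayashi (pseudo-)distance of a domain `X`: the infimum of the lengths of all chains of
holomorphic discs joining two points. For `X` open and connected, and `x`, `y` in `X`, such chains
exist, and their lengths are nonnegative. -/
noncomputable def kobayashiDist {N : ℕ} (X : Set (EuclideanSpace ℂ (Fin N)))
    (x y : EuclideanSpace ℂ (Fin N)) : ℝ :=
  sInf {L : ℝ | KobayashiChain X x y L}

/-- The Kobayashi distance from a point to `W ∩ X`, with values in the extended reals, so that it
is `⊤` if `W ∩ X` is empty. -/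
noncomputable def kobayashiDistToSet {N : ℕ} (X : Set (EuclideanSpace ℂ (Fin N)))
    (x : EuclideanSpace ℂ (Fin N)) (W : Set (EuclideanSpace ℂ (Fin N))) : EReal :=
  ⨅ w ∈ W ∩ X, (kobayashiDist X x w : EReal)

/-- The generalized halfspace `H(W, C)` with respect to the base point `x₀`. -/
def halfspace {N : ℕ} (X : Set (EuclideanSpace ℂ (Fin N))) (x₀ : EuclideanSpace ℂ (Fin N))
    (W : Set (EuclideanSpace ℂ (Fin N))) (C : ℝ) : Set (EuclideanSpace ℂ (Fin N)) :=
  {z | z ∈ X ∧ kobayashiDistToSet X z W ≤ ((kobayashiDist X z x₀ + C : ℝ) : EReal)}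

/-- The open neighbourhoods of `ξ` in the Euclidean closure of `X` (with its subspace topology). -/
def openNhdsInClosure {N : ℕ} (X : Set (EuclideanSpace ℂ (Fin N)))
    (ξ : EuclideanSpace ℂ (Fin N)) : Set (Set (EuclideanSpace ℂ (Fin N))) :=
  {V | ∃ U : Set (EuclideanSpace ℂ (Fin N)), IsOpen U ∧ ξ ∈ U ∧ V = U ∩ closure X}

/-- The star of `ξ`. Halfspaces are subsets of `X`, so their closures in the closed set `closure X`
are their closures in the ambient space. -/
def starAtInfinity {N : ℕ} (X : Set (EuclideanSpace ℂ (Fin N))) (x₀ ξ : EuclideanSpace ℂ (Fin N)) :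
    Set (EuclideanSpace ℂ (Fin N)) :=
  closure (⋃ C ∈ Ici (0 : ℝ), ⋂ V ∈ openNhdsInClosure X ξ, closure (halfspace X x₀ V C))

/-- `σ`, restricted to `[a, b]`, is a `(1, κ)`-almost geodesic of `X` for the Kobayashi distance. -/
def IsAlmostGeodesic {N : ℕ} (X : Set (EuclideanSpace ℂ (Fin N))) (κ a b : ℝ)
    (σ : ℝ → EuclideanSpace ℂ (Fin N)) : Prop :=
  ContinuousOn σ (Icc a b) ∧ MapsTo σ (Icc a b) X ∧
    ∀ s ∈ Icc a b, ∀ t ∈ Icc a b,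
      |t - s| - κ ≤ kobayashiDist X (σ t) (σ s) ∧ kobayashiDist X (σ t) (σ s) ≤ |t - s| + κ

/-- Visibility domains for the Kobayashi distance, with respect to `(1, κ)`-almost geodesics. -/
def IsVisibilityDomain {N : ℕ} (X : Set (EuclideanSpace ℂ (Fin N))) (κ : ℝ) : Prop :=
  ∀ ξ ∈ closure X \ X, ∀ η ∈ closure X \ X, ξ ≠ η →
    ∀ V W : Set (EuclideanSpace ℂ (Fin N)), V ⊆ closure X → W ⊆ closure X →
      V ∈ 𝓝[closure X] ξ → W ∈ 𝓝[closure X] η → closure V ∩ closure W = ∅ →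
      ∃ K : Set (EuclideanSpace ℂ (Fin N)), IsCompact K ∧ K ⊆ X ∧
        ∀ x ∈ V ∩ X, ∀ y ∈ W ∩ X, ∀ (a b : ℝ) (σ : ℝ → EuclideanSpace ℂ (Fin N)), a ≤ b →
          IsAlmostGeodesic X κ a b σ → σ a = x → σ b = y → ∃ t ∈ Icc a b, σ t ∈ K

/-- `(X, d)` is a proper metric space: closed balls for the Kobayashi distance are compact. On a
bounded domain the Kobayashi distance induces the Euclidean topology, so that compactness may be
taken in the latter. -/
def IsKobayashiProper {N : ℕ} (X : Set (EuclideanSpace ℂ (Fin N))) : Prop :=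
  ∀ x ∈ X, ∀ r : ℝ, IsCompact {y | y ∈ X ∧ kobayashiDist X x y ≤ r}

/-!
Let `η ≠ ξ` lie in all the closed halfspaces `closure (H(V, C))`. Then there are `z` close to `η`
and `w` close to `ξ` with `d(z, w) < d(z, x₀) + C + 1`. If `η ∈ X`, then `d(z, x₀)` is bounded
near `η`, hence so is `d(x₀, w)`. If `η` is a boundary point, an almost geodesic from `z` to `w`
meets a fixed compact set `K` in a point `p`, so `d(z, p) + d(p, w) ≤ d(z, w) + 3κ`; since
`d(x₀, p)` is bounded on `K`, the term `d(z, x₀)` cancels and `d(x₀, w)` is again bounded. In both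
cases this contradicts `d(x₀, w) → ∞` (`exists_kobayashiDist_le_of_ne` and
`eq_of_mem_iInter_closure_halfspace`).

Visibility is of use only because any two points are joined by an almost geodesic
(`exists_isAlmostGeodesic`). No infinitesimal metric is needed for this: a chain of discs of length
`L < d(x, y) + κ` carries a path on `[0, L]`, made of Poincaré geodesics parametrized by arc
length, whose subarcs are spanned by chains of length `t - s`. Thus `d(σ s, σ t) ≤ t - s`, and the
lower bound follows from the triangle inequality since the whole path is too long by at most `κ`.
-/

/-! ### Chains of holomorphic discs -/

section Chains

variable {N : ℕ} {X : Set (EuclideanSpace ℂ (Fin N))} {x y z : EuclideanSpace ℂ (Fin N)}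
  {L M : ℝ}

theorem poincareDist_nonneg (a b : ℂ) : 0 ≤ poincareDist a b :=
  Real.artanh_nonneg (by positivity)

theorem norm_one_sub_conj_mul_comm (a b : ℂ) :
    ‖1 - (starRingEnd ℂ) b * a‖ = ‖1 - (starRingEnd ℂ) a * b‖ := by
  rw [← Complex.norm_conj (1 - (starRingEnd ℂ) b * a)]
  simp [mul_comm]

theorem poincareDist_comm (a b : ℂ) : poincareDist a b = poincareDist b a := by
  rw [poincareDist, poincareDist, norm_sub_rev, norm_one_sub_conj_mul_comm]

theorem KobayashiChain.left_mem (h : KobayashiChain X x y L) : x ∈ X := by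
  induction h with
  | refl hx => exact hx
  | step _ _ _ _ _ _ _ _ _ _ _ ih => exact ih

theorem KobayashiChain.nonneg (h : KobayashiChain X x y L) : 0 ≤ L := by
  induction h with
  | refl => exact le_rfl
  | step _ _ _ _ _ _ a b _ _ _ ih => exact add_nonneg ih (poincareDist_nonneg a b)

theorem KobayashiChain.single {f : ℂ → EuclideanSpace ℂ (Fin N)}
    (hf : DifferentiableOn ℂ f (Metric.ball 0 1)) (hfX : MapsTo f (Metric.ball 0 1) X)
    {a b : ℂ} (ha : a ∈ Metric.ball (0 : ℂ) 1) (hb : b ∈ Metric.ball (0 : ℂ) 1) :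
    KobayashiChain X (f a) (f b) (poincareDist a b) := by
  simpa using KobayashiChain.step _ _ _ (.refl (f a) (hfX ha)) f hf hfX a b ha hb rfl

theorem KobayashiChain.trans (h : KobayashiChain X x y L) (h' : KobayashiChain X y z M) :
    KobayashiChain X x z (L + M) := by
  induction h' with
  | refl => simpa using h
  | step _ _ _ f hf hfX a b ha hb hfa ih =>
    rw [← add_assoc]
    exact .step _ _ _ ih f hf hfX a b ha hb hfa

theorem KobayashiChain.symm (h : KobayashiChain X x y L) : KobayashiChain X y x L := by
  induction h with
  | refl hx => exact .refl _ hx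
  | step _ _ _ f hf hfX a b ha hb hfa ih =>
    subst hfa
    rw [add_comm, poincareDist_comm]
    exact (KobayashiChain.single hf hfX hb ha).trans ih

/-- Around each point of an open set, chains consisting of one affine disc have bounded length. -/
theorem exists_eventually_kobayashiChain (hX : IsOpen X) (hx : x ∈ X) :
    ∃ L, ∀ᶠ y in 𝓝 x, KobayashiChain X x y L := by
  obtain ⟨r, hr, hball⟩ := Metric.isOpen_iff.1 hX x hx
  refine ⟨poincareDist 0 (1 / 2), ?_⟩
  filter_upwards [Metric.ball_mem_nhds x (half_pos hr)] with y hy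
  rw [Metric.mem_ball, dist_eq_norm] at hy
  let f : ℂ → EuclideanSpace ℂ (Fin N) := fun w => x + (2 * w) • (y - x)
  have hf : DifferentiableOn ℂ f (Metric.ball 0 1) := by
    dsimp only [f]
    fun_prop
  have hfX : MapsTo f (Metric.ball 0 1) X := fun w hw => hball <| by
    rw [mem_ball_zero_iff] at hw
    simp only [f, Metric.mem_ball, dist_eq_norm, add_sub_cancel_left, norm_smul, norm_mul,
      Complex.norm_ofNat]
    nlinarith [norm_nonneg w, norm_nonneg (y - x)]
  have h := KobayashiChain.single hf hfX (a := 0) (b := 1 / 2) (by simp) (by norm_num)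
  simpa [f] using h

theorem exists_kobayashiChain (hX : IsOpen X) (hconn : IsPreconnected X) (hx : x ∈ X)
    (hy : y ∈ X) : ∃ L, KobayashiChain X x y L := by
  let A : Set (EuclideanSpace ℂ (Fin N)) := {y | y ∈ X ∧ ∃ L, KobayashiChain X x y L}
  let B : Set (EuclideanSpace ℂ (Fin N)) := {y | y ∈ X ∧ ¬ ∃ L, KobayashiChain X x y L}
  have hA : IsOpen A := isOpen_iff_mem_nhds.2 fun u ⟨hu, L, hL⟩ => by
    obtain ⟨M, hM⟩ := exists_eventually_kobayashiChain hX hu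
    filter_upwards [hX.mem_nhds hu, hM] with v hv hv'
    exact ⟨hv, _, hL.trans hv'⟩
  have hB : IsOpen B := isOpen_iff_mem_nhds.2 fun u ⟨hu, hu'⟩ => by
    obtain ⟨M, hM⟩ := exists_eventually_kobayashiChain hX hu
    filter_upwards [hX.mem_nhds hu, hM] with v hv hv'
    exact ⟨hv, fun ⟨L, hL⟩ => hu' ⟨_, hL.trans hv'.symm⟩⟩
  have hAB : Disjoint A B := disjoint_left.2 fun u hu hu' => hu'.2 hu.2
  have hsub : X ⊆ A ∪ B := fun u hu =>
    (em (∃ L, KobayashiChain X x u L)).imp (fun h => ⟨hu, h⟩) (fun h => ⟨hu, h⟩)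
  exact (hconn.subset_left_of_subset_union hA hB hAB hsub
    ⟨x, hx, hx, 0, .refl x hx⟩ hy).2

end Chains

/-! ### The Kobayashi distance -/

section Distance

variable {N : ℕ} {X : Set (EuclideanSpace ℂ (Fin N))} {x y z : EuclideanSpace ℂ (Fin N)}
  {L : ℝ}

theorem KobayashiChain.kobayashiDist_le (h : KobayashiChain X x y L) :
    kobayashiDist X x y ≤ L :=
  csInf_le ⟨0, fun _ h => h.nonneg⟩ h

theorem kobayashiDist_nonneg (X : Set (EuclideanSpace ℂ (Fin N)))
    (x y : EuclideanSpace ℂ (Fin N)) : 0 ≤ kobayashiDist X x y :=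
  Real.sInf_nonneg fun _ h => h.nonneg

theorem kobayashiDist_self (hx : x ∈ X) : kobayashiDist X x x = 0 :=
  (KobayashiChain.refl x hx).kobayashiDist_le.antisymm (kobayashiDist_nonneg X x x)

theorem kobayashiDist_comm (X : Set (EuclideanSpace ℂ (Fin N)))
    (x y : EuclideanSpace ℂ (Fin N)) : kobayashiDist X x y = kobayashiDist X y x :=
  congrArg sInf <| Set.ext fun _ => ⟨fun h => h.symm, fun h => h.symm⟩

theorem exists_kobayashiChain_lt (hX : IsOpen X) (hconn : IsPreconnected X) (hx : x ∈ X)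
    (hy : y ∈ X) {ε : ℝ} (hε : 0 < ε) :
    ∃ L, KobayashiChain X x y L ∧ L < kobayashiDist X x y + ε :=
  Real.lt_sInf_add_pos (exists_kobayashiChain hX hconn hx hy) hε

theorem kobayashiDist_triangle (hX : IsOpen X) (hconn : IsPreconnected X) (hx : x ∈ X)
    (hy : y ∈ X) (hz : z ∈ X) :
    kobayashiDist X x z ≤ kobayashiDist X x y + kobayashiDist X y z := by
  refine le_of_forall_pos_le_add fun ε hε => ?_
  obtain ⟨L, hL, hL'⟩ := exists_kobayashiChain_lt hX hconn hx hy (half_pos hε)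
  obtain ⟨M, hM, hM'⟩ := exists_kobayashiChain_lt hX hconn hy hz (half_pos hε)
  linarith [(hL.trans hM).kobayashiDist_le]

theorem exists_eventually_kobayashiDist_le (hX : IsOpen X) (hconn : IsPreconnected X)
    (hx : x ∈ X) (hy : y ∈ X) : ∃ M, ∀ᶠ z in 𝓝 y, kobayashiDist X x z ≤ M := by
  obtain ⟨L, hL⟩ := exists_kobayashiChain hX hconn hx hy
  obtain ⟨M, hM⟩ := exists_eventually_kobayashiChain hX hy
  exact ⟨L + M, hM.mono fun z hz => (hL.trans hz).kobayashiDist_le⟩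

theorem IsCompact.exists_kobayashiDist_le (hX : IsOpen X) (hconn : IsPreconnected X)
    (hx : x ∈ X) {K : Set (EuclideanSpace ℂ (Fin N))} (hK : IsCompact K) (hKX : K ⊆ X) :
    ∃ M, ∀ p ∈ K, kobayashiDist X x p ≤ M := by
  refine hK.induction_on (p := fun s => ∃ M, ∀ p ∈ s, kobayashiDist X x p ≤ M) ⟨0, by simp⟩
    (fun s t hst ⟨M, hM⟩ => ⟨M, fun p hp => hM p (hst hp)⟩) ?_ fun y hy => ?_
  · rintro s t ⟨M, hM⟩ ⟨M', hM'⟩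
    refine ⟨max M M', fun p hp => ?_⟩
    rcases hp with hp | hp
    · exact (hM p hp).trans (le_max_left _ _)
    · exact (hM' p hp).trans (le_max_right _ _)
  · obtain ⟨M, hM⟩ := exists_eventually_kobayashiDist_le hX hconn hx (hKX hy)
    exact ⟨_, mem_nhdsWithin_of_mem_nhds hM, M, fun p hp => hp⟩

end Distance

/-! ### Reparametrization of discs and existence of almost geodesics -/

section AlmostGeodesics

variable {N : ℕ} {X : Set (EuclideanSpace ℂ (Fin N))} {x y : EuclideanSpace ℂ (Fin N)}

theorem normSq_one_add_conj_mul_sub (a w : ℂ) :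
    ‖1 + (starRingEnd ℂ) a * w‖ ^ 2 - ‖w + a‖ ^ 2 = (1 - ‖a‖ ^ 2) * (1 - ‖w‖ ^ 2) := by
  simp only [← Complex.normSq_eq_norm_sq, Complex.normSq_apply, Complex.add_re, Complex.add_im,
    Complex.mul_re, Complex.mul_im, Complex.conj_re, Complex.conj_im, Complex.one_re,
    Complex.one_im]
  ring

theorem one_add_conj_mul_ne_zero {a w : ℂ} (ha : ‖a‖ < 1) (hw : ‖w‖ < 1) :
    1 + (starRingEnd ℂ) a * w ≠ 0 := by
  intro h
  have h1 : (starRingEnd ℂ) a * w = -1 := by linear_combination h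
  have h2 := congrArg norm h1
  rw [norm_mul, Complex.norm_conj, norm_neg, norm_one] at h2
  nlinarith [norm_nonneg a, norm_nonneg w]

/-- The disc automorphism `w ↦ (w + a) / (1 + conj a * w)` preserves the unit disc. -/
theorem norm_mobius_lt_one {a w : ℂ} (ha : ‖a‖ < 1) (hw : ‖w‖ < 1) :
    ‖(w + a) / (1 + (starRingEnd ℂ) a * w)‖ < 1 := by
  have h0 : 0 < ‖1 + (starRingEnd ℂ) a * w‖ := norm_pos_iff.2 (one_add_conj_mul_ne_zero ha hw)
  rw [norm_div, div_lt_one h0]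
  refine lt_of_pow_lt_pow_left₀ 2 h0.le ?_
  have h1 : 0 < 1 - ‖a‖ ^ 2 := by nlinarith [norm_nonneg a]
  have h2 : 0 < 1 - ‖w‖ ^ 2 := by nlinarith [norm_nonneg w]
  linarith [normSq_one_add_conj_mul_sub a w, mul_pos h1 h2]

/-- Two points of a holomorphic disc lie at the parameters `0` and `r ≥ 0` of a reparametrized
disc, with `artanh r` their Poincaré distance: compose the disc with an automorphism moving the
first parameter to `0`, and with a rotation. -/
theorem exists_centered_disc {f : ℂ → EuclideanSpace ℂ (Fin N)}
    (hf : DifferentiableOn ℂ f (Metric.ball 0 1)) (hfX : MapsTo f (Metric.ball 0 1) X)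
    {a b : ℂ} (ha : a ∈ Metric.ball (0 : ℂ) 1) (hb : b ∈ Metric.ball (0 : ℂ) 1) :
    ∃ g : ℂ → EuclideanSpace ℂ (Fin N), DifferentiableOn ℂ g (Metric.ball 0 1) ∧
      MapsTo g (Metric.ball 0 1) X ∧ g 0 = f a ∧
      g (Real.tanh (poincareDist a b) : ℝ) = f b := by
  rw [mem_ball_zero_iff] at ha hb
  have hd : 1 - (starRingEnd ℂ) a * b ≠ 0 := by
    simpa [sub_eq_add_neg] using one_add_conj_mul_ne_zero (a := -a) (by simpa using ha) hb
  set c : ℂ := (b - a) / (1 - (starRingEnd ℂ) a * b) with hc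
  have hc1 : ‖c‖ < 1 := by
    simpa [hc, sub_eq_add_neg] using norm_mobius_lt_one (a := -a) (by simpa using ha) hb
  have htanh : Real.tanh (poincareDist a b) = ‖c‖ := by
    rw [poincareDist, norm_sub_rev, norm_one_sub_conj_mul_comm, ← norm_div]
    exact Real.tanh_artanh ⟨by linarith [norm_nonneg c], hc1⟩
  obtain ⟨u, hu, huc⟩ : ∃ u : ℂ, ‖u‖ = 1 ∧ u * ‖c‖ = c := by
    refine ⟨Complex.exp (c.arg * Complex.I), Complex.norm_exp_ofReal_mul_I _, ?_⟩
    rw [mul_comm]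
    exact Complex.norm_mul_exp_arg_mul_I c
  let φ : ℂ → ℂ := fun w => (u * w + a) / (1 + (starRingEnd ℂ) a * (u * w))
  have huw : ∀ w ∈ Metric.ball (0 : ℂ) 1, ‖u * w‖ < 1 := fun w hw => by
    simpa [hu] using hw
  have hφ : MapsTo φ (Metric.ball 0 1) (Metric.ball 0 1) := fun w hw =>
    mem_ball_zero_iff.2 (norm_mobius_lt_one ha (huw w hw))
  have hφd : DifferentiableOn ℂ φ (Metric.ball 0 1) :=
    DifferentiableOn.div (by fun_prop) (by fun_prop) fun w hw =>
      one_add_conj_mul_ne_zero ha (huw w hw)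
  refine ⟨f ∘ φ, hf.comp hφd hφ, hfX.comp hφ, by simp [φ], ?_⟩
  have hφb : φ (‖c‖ : ℝ) = b := by
    have h1 := one_add_conj_mul_ne_zero ha hc1
    simp only [φ, huc]
    have hcd : c * (1 - (starRingEnd ℂ) a * b) = b - a := div_mul_cancel₀ _ hd
    rw [div_eq_iff h1]
    linear_combination hcd
  rw [htanh, Function.comp_apply, hφb]

/-- The hyperbolic tangent parametrizes a diameter of the disc by arc length. -/
theorem poincareDist_tanh {s t : ℝ} (hst : s ≤ t) :
    poincareDist (Real.tanh s : ℝ) (Real.tanh t : ℝ) = t - s := by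
  have h1 : 0 < 1 - Real.tanh t * Real.tanh s := by
    nlinarith [Real.tanh_lt_one s, Real.tanh_lt_one t, Real.neg_one_lt_tanh s,
      Real.neg_one_lt_tanh t]
  have h2 : (Real.tanh t - Real.tanh s) / (1 - Real.tanh t * Real.tanh s) =
      Real.tanh (t - s) := by
    have hs := (Real.cosh_pos s).ne'
    have ht := (Real.cosh_pos t).ne'
    have hts := (Real.cosh_pos (t - s)).ne'
    rw [div_eq_iff h1.ne']
    simp only [Real.tanh_eq_sinh_div_cosh] at *
    rw [Real.cosh_sub] at hts ⊢
    rw [Real.sinh_sub]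
    field_simp
  have h3 : 0 ≤ (Real.tanh t - Real.tanh s) := by
    have h := (div_eq_iff h1.ne').1 h2
    rw [h]
    refine mul_nonneg ?_ h1.le
    rw [Real.tanh_eq_sinh_div_cosh]
    exact div_nonneg (Real.sinh_nonneg_iff.2 (sub_nonneg.2 hst)) (Real.cosh_pos _).le
  rw [poincareDist, norm_sub_rev, Complex.conj_ofReal, ← Complex.ofReal_mul,
    ← Complex.ofReal_sub, ← Complex.ofReal_one, ← Complex.ofReal_sub, Complex.norm_real,
    Complex.norm_real, Real.norm_of_nonneg h3, Real.norm_of_nonneg h1.le, h2,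
    Real.artanh_tanh]

/-- A path in `X` whose subarcs from time `s` to time `t` are spanned by chains of discs of length
exactly `t - s`. -/
def IsChainPath (X : Set (EuclideanSpace ℂ (Fin N))) (L : ℝ)
    (σ : ℝ → EuclideanSpace ℂ (Fin N)) : Prop :=
  ContinuousOn σ (Icc 0 L) ∧
    ∀ s t, 0 ≤ s → s ≤ t → t ≤ L → KobayashiChain X (σ s) (σ t) (t - s)

theorem exists_isChainPath_disc {f : ℂ → EuclideanSpace ℂ (Fin N)}
    (hf : DifferentiableOn ℂ f (Metric.ball 0 1)) (hfX : MapsTo f (Metric.ball 0 1) X)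
    {a b : ℂ} (ha : a ∈ Metric.ball (0 : ℂ) 1) (hb : b ∈ Metric.ball (0 : ℂ) 1) :
    ∃ σ, IsChainPath X (poincareDist a b) σ ∧ σ 0 = f a ∧ σ (poincareDist a b) = f b := by
  obtain ⟨g, hg, hgX, hga, hgb⟩ := exists_centered_disc hf hfX ha hb
  have hmem : ∀ t : ℝ, ((Real.tanh t : ℝ) : ℂ) ∈ Metric.ball (0 : ℂ) 1 := fun t => by
    rw [mem_ball_zero_iff, Complex.norm_real]
    exact Real.abs_tanh_lt_one t
  have htanh : Continuous Real.tanh := by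
    rw [show Real.tanh = fun t => Real.sinh t / Real.cosh t from
      funext Real.tanh_eq_sinh_div_cosh]
    exact Real.continuous_sinh.div Real.continuous_cosh fun t => (Real.cosh_pos t).ne'
  refine ⟨fun t => g (Real.tanh t : ℝ), ⟨?_, fun s t _ hst _ => ?_⟩, by simpa using hga, hgb⟩
  · exact hg.continuousOn.comp (Complex.continuous_ofReal.comp htanh).continuousOn
      fun t _ => hmem t
  · rw [← poincareDist_tanh hst]
    exact KobayashiChain.single hg hgX (hmem s) (hmem t)

theorem IsChainPath.concat {L M : ℝ} {σ τ : ℝ → EuclideanSpace ℂ (Fin N)} (hL : 0 ≤ L)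
    (hM : 0 ≤ M) (hσ : IsChainPath X L σ) (hτ : IsChainPath X M τ) (h : σ L = τ 0) :
    ∃ ρ, IsChainPath X (L + M) ρ ∧ ρ 0 = σ 0 ∧ ρ (L + M) = τ M := by
  let ρ : ℝ → EuclideanSpace ℂ (Fin N) := fun t => if t ≤ L then σ t else τ (t - L)
  have hρ₁ : ∀ t, t ≤ L → ρ t = σ t := fun t ht => if_pos ht
  have hρ₂ : ∀ t, L ≤ t → ρ t = τ (t - L) := fun t ht => by
    rcases ht.eq_or_lt with rfl | ht
    · rw [hρ₁ _ le_rfl, h, sub_self]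
    · exact if_neg ht.not_ge
  refine ⟨ρ, ⟨?_, fun s t hs hst ht => ?_⟩, hρ₁ 0 hL, ?_⟩
  · rw [← Icc_union_Icc_eq_Icc hL (le_add_of_nonneg_right hM)]
    refine ContinuousOn.union_of_isClosed (hσ.1.congr fun t ht => hρ₁ t ht.2) ?_
      isClosed_Icc isClosed_Icc
    refine ContinuousOn.congr (f := fun t => τ (t - L)) ?_ fun t ht => hρ₂ t ht.1
    exact hτ.1.comp (by fun_prop) fun t ht => ⟨by linarith [ht.1], by linarith [ht.2]⟩
  · rcases le_total t L with htL | htL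
    · rw [hρ₁ s (hst.trans htL), hρ₁ t htL]
      exact hσ.2 s t hs hst htL
    · rcases le_total s L with hsL | hsL
      · rw [hρ₁ s hsL, hρ₂ t htL]
        have h1 := hσ.2 s L hs hsL le_rfl
        have h2 := hτ.2 0 (t - L) le_rfl (by linarith) (by linarith)
        rw [h] at h1
        convert h1.trans h2 using 1
        ring
      · rw [hρ₂ s hsL, hρ₂ t htL]
        convert hτ.2 (s - L) (t - L) (by linarith) (by linarith) (by linarith) using 1
        ring
  · rw [hρ₂ _ (le_add_of_nonneg_right hM), add_sub_cancel_left]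

theorem KobayashiChain.exists_isChainPath {L : ℝ} (h : KobayashiChain X x y L) :
    ∃ σ, IsChainPath X L σ ∧ σ 0 = x ∧ σ L = y := by
  induction h with
  | refl hx =>
    refine ⟨fun _ => x, ⟨continuousOn_const, fun s t hs hst ht => ?_⟩, rfl, rfl⟩
    rw [show t - s = 0 by linarith]
    exact .refl x hx
  | step y L hL f hf hfX a b ha hb hfa ih =>
    obtain ⟨σ, hσ, rfl, hσL⟩ := ih
    obtain ⟨τ, hτ, hτ0, hτ1⟩ := exists_isChainPath_disc hf hfX ha hb
    obtain ⟨ρ, hρ, hρ0, hρ1⟩ := hσ.concat hL.nonneg (poincareDist_nonneg a b) hτ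
      (by rw [hσL, hτ0, hfa])
    exact ⟨ρ, hρ, hρ0, hρ1.trans hτ1⟩

/-- Any two points of a domain are joined by a `(1, κ)`-almost geodesic: a chain path whose length
exceeds the distance of its endpoints by less than `κ`. The lower bound on the distance of
intermediate points follows from the triangle inequality. -/
theorem exists_isAlmostGeodesic (hX : IsOpen X) (hconn : IsPreconnected X) (hx : x ∈ X)
    (hy : y ∈ X) {κ : ℝ} (hκ : 0 < κ) :
    ∃ L σ, 0 ≤ L ∧ IsAlmostGeodesic X κ 0 L σ ∧ σ 0 = x ∧ σ L = y := by
  obtain ⟨L, hL, hlt⟩ := exists_kobayashiChain_lt hX hconn hx hy hκ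
  obtain ⟨σ, ⟨hcont, hσ⟩, rfl, rfl⟩ := hL.exists_isChainPath
  have hmem : ∀ t ∈ Icc 0 L, σ t ∈ X := fun t ht => (hσ t t ht.1 le_rfl ht.2).left_mem
  have key : ∀ s t, 0 ≤ s → s ≤ t → t ≤ L →
      t - s - κ ≤ kobayashiDist X (σ s) (σ t) ∧ kobayashiDist X (σ s) (σ t) ≤ t - s := by
    intro s t hs hst ht
    refine ⟨?_, (hσ s t hs hst ht).kobayashiDist_le⟩
    have hs' := hmem s ⟨hs, hst.trans ht⟩
    have ht' := hmem t ⟨hs.trans hst, ht⟩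
    linarith [(hσ 0 s le_rfl hs (hst.trans ht)).kobayashiDist_le,
      (hσ t L (hs.trans hst) ht le_rfl).kobayashiDist_le,
      kobayashiDist_triangle hX hconn hx hs' hy, kobayashiDist_triangle hX hconn hs' ht' hy]
  refine ⟨L, σ, hL.nonneg, ⟨hcont, hmem, fun s hs t ht => ?_⟩, rfl, rfl⟩
  rcases le_total s t with hst | hst
  · rw [abs_of_nonneg (sub_nonneg.2 hst), kobayashiDist_comm]
    have h := key s t hs.1 hst ht.2
    exact ⟨h.1, by linarith [h.2]⟩
  · rw [abs_sub_comm, abs_of_nonneg (sub_nonneg.2 hst)]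
    have h := key t s ht.1 hst hs.2
    exact ⟨h.1, by linarith [h.2]⟩

/-- Almost geodesics almost realize the distance of their endpoints through each of their
points. -/
theorem IsAlmostGeodesic.add_le {κ a b t : ℝ} {σ : ℝ → EuclideanSpace ℂ (Fin N)}
    (h : IsAlmostGeodesic X κ a b σ) (ht : t ∈ Icc a b) :
    kobayashiDist X (σ a) (σ t) + kobayashiDist X (σ t) (σ b) ≤
      kobayashiDist X (σ a) (σ b) + 3 * κ := by
  have ha : a ∈ Icc a b := ⟨le_rfl, ht.1.trans ht.2⟩
  have hb : b ∈ Icc a b := ⟨ht.1.trans ht.2, le_rfl⟩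
  have h1 := (h.2.2 t ht a ha).2
  have h2 := (h.2.2 b hb t ht).2
  have h3 := (h.2.2 b hb a ha).1
  rw [abs_sub_comm, abs_of_nonneg (sub_nonneg.2 ht.1)] at h1
  rw [abs_sub_comm, abs_of_nonneg (sub_nonneg.2 ht.2)] at h2
  rw [abs_sub_comm, abs_of_nonneg (sub_nonneg.2 (ht.1.trans ht.2))] at h3
  linarith

end AlmostGeodesics

/-! ### Halfspaces and stars -/

section Stars

variable {N : ℕ} {X : Set (EuclideanSpace ℂ (Fin N))} {x₀ ξ η z : EuclideanSpace ℂ (Fin N)}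

theorem exists_mem_of_mem_halfspace {W : Set (EuclideanSpace ℂ (Fin N))} {C : ℝ}
    (hz : z ∈ halfspace X x₀ W C) :
    ∃ w ∈ W ∩ X, kobayashiDist X z w < kobayashiDist X z x₀ + C + 1 := by
  have h : kobayashiDistToSet X z W < ((kobayashiDist X z x₀ + C + 1 : ℝ) : EReal) :=
    hz.2.trans_lt (EReal.coe_lt_coe_iff.2 (lt_add_one _))
  simp only [kobayashiDistToSet, iInf_lt_iff, EReal.coe_lt_coe_iff] at h
  obtain ⟨w, hw, h⟩ := h
  exact ⟨w, hw, h⟩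

theorem inter_subset_halfspace (W : Set (EuclideanSpace ℂ (Fin N))) {C : ℝ} (hC : 0 ≤ C) :
    W ∩ X ⊆ halfspace X x₀ W C := fun z hz => by
  refine ⟨hz.2, (iInf₂_le z hz).trans ?_⟩
  rw [kobayashiDist_self hz.2, EReal.coe_le_coe_iff]
  exact add_nonneg (kobayashiDist_nonneg X z x₀) hC

theorem mem_starAtInfinity_self (hξ : ξ ∈ closure X) : ξ ∈ starAtInfinity X x₀ ξ := by
  refine subset_closure (mem_iUnion₂.2 ⟨0, self_mem_Ici, mem_iInter₂.2 ?_⟩)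
  rintro V ⟨U, hU, hξU, rfl⟩
  refine closure_mono (inter_subset_halfspace _ le_rfl) (closure_mono ?_
    (hU.inter_closure ⟨hξU, hξ⟩))
  exact fun z hz => ⟨⟨hz.1, subset_closure hz.2⟩, hz.2⟩

/-- If `η` is different from the boundary point `ξ`, then the points near `ξ` that are not much
further away from a point near `η` than `x₀` is stay within bounded distance of `x₀`. For `η` on
the boundary this is visibility: an almost geodesic between the two points meets a fixed compact
set. -/
theorem exists_kobayashiDist_le_of_ne (hX : IsOpen X) (hconn : IsPreconnected X) {κ : ℝ}
    (hκ : 0 < κ) (hvis : IsVisibilityDomain X κ) (hx₀ : x₀ ∈ X) (hξ : ξ ∈ closure X \ X)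
    (hη : η ∈ closure X) (hne : η ≠ ξ) (C : ℝ) :
    ∃ R, ∃ A ∈ 𝓝 ξ, ∃ B ∈ 𝓝 η, ∀ w ∈ A ∩ X, ∀ z ∈ B ∩ X,
      kobayashiDist X z w < kobayashiDist X z x₀ + C → kobayashiDist X x₀ w ≤ R := by
  by_cases hηX : η ∈ X
  · obtain ⟨M, hM⟩ := exists_eventually_kobayashiDist_le hX hconn hx₀ hηX
    refine ⟨2 * M + C, univ, univ_mem, _, hM, fun w ⟨_, hw⟩ z ⟨hzM, hz⟩ hzw => ?_⟩
    rw [mem_ofPred_eq] at hzM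
    rw [kobayashiDist_comm X z x₀] at hzw
    linarith [kobayashiDist_triangle hX hconn hx₀ hz hw]
  · obtain ⟨A, hA, B, hB, hAB⟩ := exists_nhds_disjoint_closure hne.symm
    obtain ⟨K, hK, hKX, hmeet⟩ := hvis η ⟨hη, hηX⟩ ξ hξ hne (B ∩ closure X) (A ∩ closure X)
      inter_subset_right inter_subset_right
      (inter_mem (mem_nhdsWithin_of_mem_nhds hB) self_mem_nhdsWithin)
      (inter_mem (mem_nhdsWithin_of_mem_nhds hA) self_mem_nhdsWithin)
      (disjoint_iff_inter_eq_empty.1 <|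
        hAB.symm.mono (closure_mono inter_subset_left) (closure_mono inter_subset_left))
    obtain ⟨M, hM⟩ := hK.exists_kobayashiDist_le hX hconn hx₀ hKX
    refine ⟨2 * M + C + 3 * κ, A, hA, B, hB, fun w ⟨hwA, hw⟩ z ⟨hzB, hz⟩ hzw => ?_⟩
    obtain ⟨L, σ, hL, hσ, rfl, rfl⟩ := exists_isAlmostGeodesic hX hconn hz hw hκ
    obtain ⟨t, ht, htK⟩ := hmeet _ ⟨⟨hzB, subset_closure hz⟩, hz⟩ _
      ⟨⟨hwA, subset_closure hw⟩, hw⟩ 0 L σ hL hσ rfl rfl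
    have h1 := hσ.add_le ht
    have h2 := hM _ htK
    have h3 := kobayashiDist_triangle hX hconn hz (hKX htK) hx₀
    rw [kobayashiDist_comm X (σ t) x₀] at h3
    linarith [kobayashiDist_triangle hX hconn hx₀ (hKX htK) hw]

theorem eq_of_mem_iInter_closure_halfspace (hX : IsOpen X) (hconn : IsPreconnected X) {κ : ℝ}
    (hκ : 0 < κ) (hvis : IsVisibilityDomain X κ) (hx₀ : x₀ ∈ X) (hξ : ξ ∈ closure X \ X)
    (hinf : Tendsto (fun x => kobayashiDist X x₀ x) (𝓝[X] ξ) atTop) {C : ℝ}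
    (hη : η ∈ ⋂ V ∈ openNhdsInClosure X ξ, closure (halfspace X x₀ V C)) : η = ξ := by
  by_contra hne
  rw [mem_iInter₂] at hη
  have hηX : η ∈ closure X :=
    closure_mono (fun z hz => hz.1) (hη (univ ∩ closure X) ⟨univ, isOpen_univ, mem_univ ξ, rfl⟩)
  obtain ⟨R, A, hA, B, hB, hR⟩ :=
    exists_kobayashiDist_le_of_ne hX hconn hκ hvis hx₀ hξ hηX hne (C + 1)
  have hfar : ∀ᶠ w in 𝓝 ξ, w ∈ X → R < kobayashiDist X x₀ w :=
    eventually_nhdsWithin_iff.1 (hinf.eventually_gt_atTop R)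
  obtain ⟨U, hUsub, hU, hξU⟩ := mem_nhds_iff.1 (inter_mem hA hfar)
  obtain ⟨z, hzB, hz⟩ :=
    mem_closure_iff_nhds.1 (hη (U ∩ closure X) ⟨U, hU, hξU, rfl⟩) B hB
  obtain ⟨w, ⟨⟨hwU, -⟩, hw⟩, hzw⟩ := exists_mem_of_mem_halfspace hz
  have hlt : R < kobayashiDist X x₀ w := (hUsub hwU).2 hw
  refine hlt.not_ge (hR w ⟨(hUsub hwU).1, hw⟩ z ⟨hzB, hz.1⟩ ?_)
  rwa [← add_assoc]

theorem starAtInfinity_eq_singleton (hX : IsOpen X) (hconn : IsPreconnected X) {κ : ℝ}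
    (hκ : 0 < κ) (hvis : IsVisibilityDomain X κ) (hx₀ : x₀ ∈ X) (hξ : ξ ∈ closure X \ X)
    (hinf : Tendsto (fun x => kobayashiDist X x₀ x) (𝓝[X] ξ) atTop) :
    starAtInfinity X x₀ ξ = {ξ} := by
  refine Subset.antisymm (closure_minimal ?_ isClosed_singleton)
    (singleton_subset_iff.2 (mem_starAtInfinity_self hξ.1))
  exact iUnion₂_subset fun C _ η hη =>
    eq_of_mem_iInter_closure_halfspace hX hconn hκ hvis hx₀ hξ hinf hη

/-- A compact ball does not accumulate at points outside of `X`. -/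
theorem IsKobayashiProper.tendsto_kobayashiDist_atTop (hprop : IsKobayashiProper X) (hx₀ : x₀ ∈ X)
    (hξ : ξ ∉ X) : Tendsto (fun x => kobayashiDist X x₀ x) (𝓝[X] ξ) atTop := by
  refine tendsto_atTop.2 fun r => ?_
  have hnhds : {y | y ∈ X ∧ kobayashiDist X x₀ y ≤ r}ᶜ ∈ 𝓝 ξ :=
    (hprop x₀ hx₀ r).isClosed.isOpen_compl.mem_nhds fun h => hξ h.1
  filter_upwards [mem_nhdsWithin_of_mem_nhds hnhds, self_mem_nhdsWithin] with y hy hyX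
  exact (not_le.1 fun h => hy ⟨hyX, h⟩).le

end Stars

theorem mainTheorem5 {N : ℕ} (X : Set (EuclideanSpace ℂ (Fin N)))
    (hXopen : IsOpen X) (hXconn : IsConnected X) (hXbdd : Bornology.IsBounded X)
    (κ : ℝ) (hκ : 0 < κ) (hvis : IsVisibilityDomain X κ)
    (x₀ : EuclideanSpace ℂ (Fin N)) (hx₀ : x₀ ∈ X) :
    (∀ ξ ∈ closure X \ X, Tendsto (fun x => kobayashiDist X x₀ x) (𝓝[X] ξ) atTop →
      starAtInfinity X x₀ ξ = {ξ}) ∧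
    (IsKobayashiProper X → ∀ ξ ∈ closure X \ X, starAtInfinity X x₀ ξ = {ξ}) :=
  ⟨fun _ hξ hinf =>
      starAtInfinity_eq_singleton hXopen hXconn.isPreconnected hκ hvis hx₀ hξ hinf,
    fun hprop _ hξ =>
      starAtInfinity_eq_singleton hXopen hXconn.isPreconnected hκ hvis hx₀ hξ
        (hprop.tendsto_kobayashiDist_atTop hx₀ hξ.2)⟩
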